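/- Let $\mathbb{F}_q$ be a finite field with $q$ elements, $K=\overline{\mathbb{F}}_q$ an algebraic closure of it, and let $\mathcal{C}\subset\mathbb{P}^2$ be a plane curve over $K$ defined by a homogeneous polynomial with coefficients in $\mathbb{F}_q$ that is irreducible over $K$. Let $\mathrm{Sing}(\mathcal{C})$ be the set of its singular points, $T_R\mathcal{C}$ the tangent line at a smooth point $R$, and $r:\hat{\mathcal{C}}\to\mathcal{C}$ the normalization. Write $R^q=(x^q:y^q:z^q)$ for the $q$-Frobenius image of a point $R=(x:y:z)\in\mathbb{P}^2(K)$. Assume that $\mathcal{C}$ is $q$-Frobenius nonclassical, that is, $R^q\in T_R\mathcal{C}$ for every smooth point $R$ of $\mathcal{C}$. Let $P\in\mathbb{P}^2(K)$ be a Galois point for $\mathcal{C}$: the projection $\pi_P:\mathcal{C}\dashrightarrow\mathbb{P}^1$ from $P$ induces a (finite) Galois extension $K(\mathcal{C})/\pi_P^*K(\mathbb{P}^1)$ of function fields. Let $Q\in\mathcal{C}\setminus\mathrm{Sing}(\mathcal{C})$ be a ramification point for the projection from $P$: the ramification index of $\hat\pi_P=\pi_P\circ r:\hat{\mathcal{C}}\to\mathbb{P}^1$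 at the unique point of $\hat{\mathcal{C}}$ over $Q$ is greater than $1$. Write $\overline{PQ}$ for the line through $P$ and $Q$ if $P\ne Q$. A line is said to be defined over $\mathbb{F}_q$ if it has a linear equation with coefficients in $\mathbb{F}_q$. Then the following hold. (a) If $P\in(\mathbb{P}^2\setminus\mathcal{C})\cup\mathrm{Sing}(\mathcal{C})$, then the line $\overline{PQ}$ is defined over $\mathbb{F}_q$. (b) If $P=Q$, then the tangent line $T_P\mathcal{C}$ at $P$ is defined over $\mathbb{F}_q$. (c) If $P\in\mathcal{C}\setminus\mathrm{Sing}(\mathcal{C})$, $P\neq Q$, and there exists a point $Q'\in(\mathcal{C}\setminus\mathrm{Sing}(\mathcal{C}))\cap(\overline{PQ}\setminus\{P,Q\})$, then the line $\overline{PQ}$ is defined over $\mathbb{F}_q$. -/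

import Mathlib

open scoped LinearAlgebra.Projectivization

noncomputable section

/-- Points of the projective plane over `K`. -/
abbrev ProjPlane (K : Type*) [Field K] : Type _ := ℙ K (Fin 3 → K)

/-- A projective plane curve over `F`, irreducible over the extension `K` of `F` (which is going to
be an algebraic closure of `F`), given by its homogeneous equation. -/
structure PlaneCurve (F K : Type*) [Field F] [Field K] [Algebra F K] where
  /-- the equation of the curve, with coefficients in the base field -/
  poly : MvPolynomial (Fin 3) F
  /-- the degree of the curve -/
  degree : ℕ
  isHomogeneous : poly.IsHomogeneous degree
  irreducible : Irreducible (MvPolynomial.map (algebraMap F K) poly)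

/-- The line joining two distinct points, as a set of points. -/
def lineThrough {K : Type*} [Field K] (P Q : ProjPlane K) : Set (ProjPlane K) :=
  {R | R.submodule ≤ P.submodule ⊔ Q.submodule}

/-- The set `L` of points over `K` is a line with an equation `a₀ x + a₁ y + a₂ z = 0` whose
coefficients `a₀, a₁, a₂` lie in `F`. -/
def IsLineDefinedOver (F : Type*) {K : Type*} [Field F] [Field K] [Algebra F K]
    (L : Set (ProjPlane K)) : Prop :=
  ∃ a : Fin 3 → F, a ≠ 0 ∧ L = {R | ∑ i, algebraMap F K (a i) * R.rep i = 0}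

/-- The image `(x^q : y^q : z^q)` of the point `(x : y : z)`, where `q` is the cardinality
of `F`. -/
def frobeniusPoint (F : Type*) {K : Type*} [Fintype F] [Field K] (R : ProjPlane K) :
    ProjPlane K :=
  Projectivization.mk K (fun i => R.rep i ^ Fintype.card F) (by
    intro h
    apply R.rep_nonzero
    funext i
    exact eq_zero_of_pow_eq_zero (congrFun h i))

namespace PlaneCurve

variable {F K : Type*} [Field F] [Field K] [Algebra F K] (C : PlaneCurve F K)

/-- The equation of the curve, with coefficients in `K`. -/
def equation : MvPolynomial (Fin 3) K := MvPolynomial.map (algebraMap F K) C.poly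

/-- The point `R` of the plane lies on the curve. -/
def OnCurve (R : ProjPlane K) : Prop := MvPolynomial.eval R.rep C.equation = 0

/-- The partial derivatives of the equation at (the chosen coordinates of) the point `R`. -/
def gradient (R : ProjPlane K) (i : Fin 3) : K :=
  MvPolynomial.eval R.rep (MvPolynomial.pderiv i C.equation)

/-- `R` is a smooth point of the curve. -/
def IsSmoothAt (R : ProjPlane K) : Prop := C.OnCurve R ∧ C.gradient R ≠ 0

/-- `R` is a singular point of the curve. -/
def IsSingularAt (R : ProjPlane K) : Prop := C.OnCurve R ∧ C.gradient R = 0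

/-- The tangent line of the curve at a smooth point `R`, as a set of points. -/
def tangentLine (R : ProjPlane K) : Set (ProjPlane K) :=
  {T | ∑ i, C.gradient R i * T.rep i = 0}

/-- A curve over the field `F` of `q` elements is `q`-Frobenius nonclassical if the `q`-Frobenius
image of each smooth point `R` lies on the tangent line at `R`. -/
def IsFrobeniusNonclassical [Fintype F] : Prop :=
  ∀ R : ProjPlane K, C.IsSmoothAt R → frobeniusPoint F R ∈ C.tangentLine R

/-- The homogeneous coordinate ring of the curve over `K`. -/
abbrev CoordRing : Type _ := MvPolynomial (Fin 3) K ⧸ Ideal.span {C.equation}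

instance : IsDomain C.CoordRing := by
  have h : Prime C.equation := C.irreducible.prime
  have : (Ideal.span {C.equation}).IsPrime := (Ideal.span_singleton_prime h.ne_zero).2 h
  infer_instance

/-- The quotient `a / b` in the fraction field of the homogeneous coordinate ring. -/
def frac (a b : MvPolynomial (Fin 3) K) : FractionRing C.CoordRing :=
  algebraMap C.CoordRing _ (Ideal.Quotient.mk _ a) /
    algebraMap C.CoordRing _ (Ideal.Quotient.mk _ b)

/-- The function field `K(C)` of the curve: the quotients of forms of equal degree. -/
def functionField : IntermediateField K (FractionRing C.CoordRing) :=
  IntermediateField.adjoin K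
    {f | ∃ (n : ℕ) (a b : MvPolynomial (Fin 3) K),
      a.IsHomogeneous n ∧ b.IsHomogeneous n ∧ f = C.frac a b}

/-- The subfield of `K(C)` that is the pull-back of the function field of `ℙ¹` under the
projection from the point `P`: it is generated over `K` by the quotients of the linear forms that
vanish at `P`. -/
def projectionField (P : ProjPlane K) : IntermediateField K C.functionField :=
  IntermediateField.adjoin K
    {f | ∃ a b : MvPolynomial (Fin 3) K, a.IsHomogeneous 1 ∧ b.IsHomogeneous 1 ∧
      MvPolynomial.eval P.rep a = 0 ∧ MvPolynomial.eval P.rep b = 0 ∧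
      (f : FractionRing C.CoordRing) = C.frac a b}

/-- `P` is a Galois point for the curve: the extension of function fields induced by the projection
from `P` is (finite) Galois. -/
def IsGaloisPoint (P : ProjPlane K) : Prop :=
  FiniteDimensional (C.projectionField P) C.functionField ∧
    IsGalois (C.projectionField P) C.functionField

/-- A point of the normalization of the curve, as a place of the function field: a valuation ring
of `K(C)` that contains the constants and is not the whole field. -/
structure Place where
  /-- the ring of the functions that are regular at the place -/
  ring : ValuationSubring C.functionField
  constants_mem : ∀ c : K, algebraMap K C.functionField c ∈ ring
  ne_top : ring ≠ ⊤

variable {C}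

/-- The normalization map sends the place `v` to the point `Q` of the curve: the valuation ring of
`v` dominates the local ring of the curve at `Q`, which consists of the quotients `a / b` of forms
of equal degree with `b(Q) ≠ 0`, and in which the nonunits are those with `a(Q) = 0`. -/
def Place.LiesOver (v : C.Place) (Q : ProjPlane K) : Prop :=
  C.OnCurve Q ∧
    ∀ (n : ℕ) (a b : MvPolynomial (Fin 3) K) (f : C.functionField),
      a.IsHomogeneous n → b.IsHomogeneous n → MvPolynomial.eval Q.rep b ≠ 0 →
      (f : FractionRing C.CoordRing) = C.frac a b →
      f ∈ v.ring ∧ (MvPolynomial.eval Q.rep a = 0 → f ∈ v.ring.nonunits)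

/-- The local ring of `ℙ¹` at the image of the place `v` under the projection from `P`, as a subring
of the function field of `ℙ¹`. -/
def Place.imageRing (v : C.Place) (P : ProjPlane K) : ValuationSubring (C.projectionField P) :=
  v.ring.comap (algebraMap (C.projectionField P) C.functionField)

/-- The inclusion of the local ring of the image point in the local ring of the place. -/
def Place.imageRingHom (v : C.Place) (P : ProjPlane K) : v.imageRing P →+* v.ring :=
  (algebraMap (C.projectionField P) C.functionField).restrict
    (v.imageRing P) v.ring (fun _ h => h)

/-- The ramification index at the place `v` of the projection from `P`, as a map from the
normalization of the curve to `ℙ¹`. -/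
def Place.ramificationIndex (v : C.Place) (P : ProjPlane K) : ℕ :=
  letI : Algebra (v.imageRing P) v.ring := (v.imageRingHom P).toAlgebra
  Ideal.ramificationIdx' (IsLocalRing.maximalIdeal (v.imageRing P))
    (IsLocalRing.maximalIdeal v.ring)

variable (C)

/-- The smooth point `Q` is a ramification point of the projection from `P`: the ramification index
at the (unique) place over `Q` is greater than one. -/
def IsRamificationPoint (P Q : ProjPlane K) : Prop :=
  ∃ v : C.Place, v.LiesOver Q ∧ 1 < v.ramificationIndex P

end PlaneCurve

end

/-! Let `α` be the equation of a line through `P`, `γ` another linear form vanishing at `P`, and `t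
= α/γ`, so that the projection from `P` corresponds to the field `K(t)`. Let `R ≠ P` be a smooth
point on `α = 0`. If the line is not tangent at `R`, then `t` is a uniformizer at `R`. Since
`K(C)/K(t)` is Galois, the places over `t = 0` are conjugate, so none of them is ramified. Hence a
line through `P` whose fibre contains a ramified place is tangent at every smooth point on it other
than `P` (`IsGaloisPoint.not_linearIndependent`).

Applied to the place over `Q`, this shows that `T_Q` passes through `P`, and that `T_R = T_Q` for
each smooth `R ≠ P` on `T_Q` (`IsGaloisPoint.exists_gradient_eq_smul`). By nonclassicality `Q^q`
lies on `T_Q`, and it is smooth. If `Q^q ≠ P`, then `T_Q` equals the tangent at `Q^q`, whose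
coefficients are the `q`-th powers of those of `T_Q`; so `T_Q` is defined over `F`. The exception
`Q^q = P` is impossible in (a), makes `P` rational in (b), and in (c) is avoided by replacing `Q`
with `Q'`, as Frobenius is injective on points.

Places are arbitrary valuation rings, so conjugacy is proved by prime avoidance, and "uniformizer"
means generator of the maximal ideal. -/

/-! ### Linear forms and homogeneous polynomials at a point -/

open Matrix in
theorem finrank_ker_flip_dotProductBilin {K : Type*} [Field K] {p : Fin 3 → K} (hp : p ≠ 0) :
    Module.finrank K (LinearMap.ker ((dotProductBilin K K).flip p)) = 2 := by
  set φ := (dotProductBilin K K).flip p with h0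
  have hφ (v) : φ v = v ⬝ᵥ p := rfl
  have hsurj : Function.Surjective φ := by
    refine LinearMap.surjective ?_
    intro h
    apply hp
    funext i
    have := hφ (Pi.single i 1)
    simpa [h] using this.symm
  have := φ.finrank_range_add_finrank_ker
  rw [LinearMap.range_eq_top.2 hsurj, finrank_top] at this
  simp at this
  omega

open Matrix in
theorem exists_eq_smul_add_smul_of_dotProduct_eq_zero {K : Type*} [Field K]
    {p β γ δ : Fin 3 → K} (hp : p ≠ 0) (hβγ : LinearIndependent K ![β, γ])
    (hβ : β ⬝ᵥ p = 0) (hγ : γ ⬝ᵥ p = 0) (hδ : δ ⬝ᵥ p = 0) :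
    ∃ s u : K, δ = s • β + u • γ := by
  let φ : (Fin 3 → K) →ₗ[K] K := (dotProductBilin K K).flip p
  have hφ (v) : φ v = v ⬝ᵥ p := rfl
  have hker : Module.finrank K (LinearMap.ker φ) = 2 := finrank_ker_flip_dotProductBilin hp
  have hle : Submodule.span K (Set.range ![β, γ]) ≤ LinearMap.ker φ := by
    rw [Submodule.span_le]
    rintro _ ⟨i, rfl⟩
    fin_cases i <;> simp [hφ, hβ, hγ]
  have heq := Submodule.eq_of_le_of_finrank_eq hle (by
    rw [hker, finrank_span_eq_card hβγ]; simp)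
  have hmem : δ ∈ Submodule.span K (Set.range ![β, γ]) := by
    rw [heq]; simpa [hφ] using hδ
  rw [Matrix.range_cons_cons_empty] at hmem
  obtain ⟨s, u, h⟩ := Submodule.mem_span_pair.1 hmem
  exact ⟨s, u, h.symm⟩

/-- The linear form with the given coefficients. -/
noncomputable def linForm {K : Type*} [Field K] (α : Fin 3 → K) : MvPolynomial (Fin 3) K :=
  ∑ i, MvPolynomial.C (α i) * MvPolynomial.X i

namespace MvPolynomial

variable {K : Type*} [Field K]

open Matrix in
@[simp]
theorem eval_linForm (α x : Fin 3 → K) : eval x (linForm α) = α ⬝ᵥ x := by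
  simp [linForm, dotProduct]

theorem IsHomogeneous.eval_smul {σ : Type*} [Fintype σ] {f : MvPolynomial σ K} {n : ℕ}
    (hf : f.IsHomogeneous n) (a : K) (x : σ → K) : eval (a • x) f = a ^ n * eval x f := by
  rw [eval_eq', eval_eq', Finset.mul_sum]
  refine Finset.sum_congr rfl fun d hd => ?_
  have hdeg : ∑ i, d i = n := by
    rw [← Finsupp.degree_eq_sum]
    by_contra hne
    exact (mem_support_iff.1 hd) (hf.coeff_eq_zero hne)
  simp only [Pi.smul_apply, smul_eq_mul, mul_pow, Finset.prod_mul_distrib,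
    Finset.prod_pow_eq_pow_sum, hdeg]
  ring

theorem isHomogeneous_linForm (α : Fin 3 → K) : (linForm α).IsHomogeneous 1 :=
  IsHomogeneous.sum _ _ _ fun _ _ => isHomogeneous_C_mul_X _ _

theorem linForm_add (α β : Fin 3 → K) : linForm (α + β) = linForm α + linForm β := by
  simp [linForm, add_mul, Finset.sum_add_distrib]

theorem linForm_smul (c : K) (α : Fin 3 → K) : linForm (c • α) = C c * linForm α := by
  simp [linForm, Finset.mul_sum, mul_assoc]

theorem linForm_single (i : Fin 3) : linForm (Pi.single i (1 : K)) = X i := by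
  simp [linForm, Pi.single_apply]

@[simp]
theorem pderiv_linForm (α : Fin 3 → K) (i : Fin 3) : pderiv i (linForm α) = C (α i) := by
  simp [linForm, Pi.single_apply]

-- In the coordinates `β, γ, δ` the point `p` is `(0, 0, 1)`. Modulo `β` and `γ` each `X i` becomes
-- `p i • δ`, so a form of degree `n + 1` becomes its value at `p` times `δ ^ (n + 1)`.
open Matrix in
theorem IsHomogeneous.exists_eq_linForm_mul_add {p β γ δ : Fin 3 → K}
    (hβγ : LinearIndependent K ![β, γ]) (hβ : β ⬝ᵥ p = 0) (hγ : γ ⬝ᵥ p = 0) (hδ : δ ⬝ᵥ p = 1)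
    {n : ℕ} {g : MvPolynomial (Fin 3) K} (hg : g.IsHomogeneous (n + 1)) :
    ∃ g₁ g₂ : MvPolynomial (Fin 3) K, g₁.IsHomogeneous n ∧ g₂.IsHomogeneous n ∧
      g = linForm β * g₁ + linForm γ * g₂ + C (eval p g) * linForm δ ^ (n + 1) := by
  have hp : p ≠ 0 := by rintro rfl; simp at hδ
  have hX (i : Fin 3) : ∃ s u : K,
      X i = C s * linForm β + C u * linForm γ + C (p i) * linForm δ := by
    obtain ⟨s, u, h⟩ := exists_eq_smul_add_smul_of_dotProduct_eq_zero (δ := Pi.single i 1 - p i • δ)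
      hp hβγ hβ hγ (by simp [sub_dotProduct, hδ])
    refine ⟨s, u, ?_⟩
    rw [← linForm_single, ← linForm_smul, ← linForm_smul, ← linForm_smul, ← linForm_add,
      ← linForm_add, ← h, sub_add_cancel]
  have hmon (n : ℕ) : ∀ (d : Fin 3 →₀ ℕ), d.degree = n + 1 → ∀ c : K,
      ∃ g₁ g₂ : MvPolynomial (Fin 3) K, g₁.IsHomogeneous n ∧ g₂.IsHomogeneous n ∧
      monomial d c = linForm β * g₁ + linForm γ * g₂ +
        C (eval p (monomial d c)) * linForm δ ^ (n + 1) := by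
    induction n with
    | zero =>
      intro d hd c
      have hd' : ∃ i, d = Finsupp.single i 1 := by
        obtain ⟨i, hi⟩ : ∃ i, d i ≠ 0 := by
          by_contra! h
          have : d = 0 := Finsupp.ext h
          simp [this] at hd
        have hle : Finsupp.single i 1 ≤ d := by simpa [Nat.one_le_iff_ne_zero] using hi
        have hsub := add_tsub_cancel_of_le hle
        refine ⟨i, ?_⟩
        have h0 : (d - Finsupp.single i 1).degree = 0 := by
          have := congrArg Finsupp.degree hsub
          rw [map_add, Finsupp.degree_single] at this
          omega
        rw [Finsupp.degree_eq_zero_iff] at h0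
        rw [← hsub, h0, add_zero]
      obtain ⟨i, rfl⟩ := hd'
      obtain ⟨s, u, h⟩ := hX i
      refine ⟨C (c * s), C (c * u), isHomogeneous_C _ _, isHomogeneous_C _ _, ?_⟩
      have : monomial (Finsupp.single i 1) c = C c * X i := by
        rw [C_mul_X_eq_monomial]
      rw [this, map_mul (eval p), eval_C, eval_X]
      conv_lhs => rw [h]
      simp only [map_mul]
      ring
    | succ n ih =>
      intro d hd c
      obtain ⟨i, hi⟩ : ∃ i, d i ≠ 0 := by
        by_contra! h
        have : d = 0 := Finsupp.ext h
        simp [this] at hd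
      obtain ⟨d', rfl⟩ : ∃ d', d = Finsupp.single i 1 + d' :=
        ⟨d - Finsupp.single i 1, by
          rw [add_tsub_cancel_of_le]
          simpa [Nat.one_le_iff_ne_zero] using hi⟩
      have hd' : d'.degree = n + 1 := by
        rw [map_add, Finsupp.degree_single] at hd; omega
      obtain ⟨g₁, g₂, h₁, h₂, h⟩ := ih d' hd' c
      obtain ⟨s, u, hs⟩ := hX i
      set e := eval p (monomial d' c)
      have hm : monomial (Finsupp.single i 1 + d') c = X i * monomial d' c := by
        rw [X, monomial_mul, one_mul]
      refine ⟨X i * g₁ + C (e * s) * linForm δ ^ (n + 1),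
        X i * g₂ + C (e * u) * linForm δ ^ (n + 1), ?_, ?_, ?_⟩
      · refine IsHomogeneous.add ?_ ?_
        · rw [add_comm]; exact (isHomogeneous_X _ _).mul h₁
        · simpa using ((isHomogeneous_linForm δ).pow (n + 1)).C_mul (e * s)
      · refine IsHomogeneous.add ?_ ?_
        · rw [add_comm]; exact (isHomogeneous_X _ _).mul h₂
        · simpa using ((isHomogeneous_linForm δ).pow (n + 1)).C_mul (e * u)
      · rw [hm, map_mul (eval p), eval_X]
        conv_lhs => rw [h]
        have : X i * (C e * linForm δ ^ (n + 1)) = (C s * linForm β + C u * linForm γ +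
          C (p i) * linForm δ) * (C e * linForm δ ^ (n + 1)) := by rw [← hs]
        rw [mul_add, this]
        change _ = _ + C (p i * e) * _
        simp only [map_mul]
        ring
  choose! G₁ G₂ h₁ h₂ h using hmon n
  have hdeg (d) (hd : d ∈ g.support) : d.degree = n + 1 := by
    by_contra hne
    exact (mem_support_iff.1 hd) (hg.coeff_eq_zero hne)
  refine ⟨∑ d ∈ g.support, G₁ d (coeff d g), ∑ d ∈ g.support, G₂ d (coeff d g),
    IsHomogeneous.sum _ _ _ fun d hd => h₁ d (hdeg d hd) _,
    IsHomogeneous.sum _ _ _ fun d hd => h₂ d (hdeg d hd) _, ?_⟩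
  have hev : eval p g = ∑ d ∈ g.support, eval p (monomial d (coeff d g)) := by
    rw [← map_sum, ← as_sum]
  rw [hev, map_sum, Finset.mul_sum, Finset.mul_sum, Finset.sum_mul, ← Finset.sum_add_distrib,
    ← Finset.sum_add_distrib]
  conv_lhs => rw [as_sum g]
  exact Finset.sum_congr rfl fun d hd => h d (hdeg d hd) _

open Matrix in
theorem IsHomogeneous.exists_eq_linForm_mul_add_linForm_mul {p β γ : Fin 3 → K} (hp : p ≠ 0)
    (hβγ : LinearIndependent K ![β, γ]) (hβ : β ⬝ᵥ p = 0) (hγ : γ ⬝ᵥ p = 0)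
    {n : ℕ} {g : MvPolynomial (Fin 3) K} (hg : g.IsHomogeneous (n + 1)) (h0 : eval p g = 0) :
    ∃ g₁ g₂ : MvPolynomial (Fin 3) K, g₁.IsHomogeneous n ∧ g₂.IsHomogeneous n ∧
      g = linForm β * g₁ + linForm γ * g₂ := by
  obtain ⟨i, hi⟩ := Function.ne_iff.1 hp
  obtain ⟨g₁, g₂, h₁, h₂, h⟩ := hg.exists_eq_linForm_mul_add (δ := Pi.single i (p i)⁻¹) hβγ hβ hγ
    (by simpa using inv_mul_cancel₀ hi)
  refine ⟨g₁, g₂, h₁, h₂, ?_⟩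
  simpa [h0] using h

end MvPolynomial

/-! ### Conjugacy of valuation rings in a Galois extension -/

section
open Polynomial

/-- Over a common valuation ring of the base field, an element all of whose conjugates lie in one
valuation ring lies in the other one. -/
theorem ValuationSubring.mem_of_forall_algEquiv_mem {k L : Type*} [Field k] [Field L] [Algebra k L]
    [FiniteDimensional k L] [IsGalois k L] {V W : ValuationSubring L}
    (hVW : ∀ x : k, algebraMap k L x ∈ V → algebraMap k L x ∈ W) {y : L}
    (hy : ∀ σ : L ≃ₐ[k] L, σ y ∈ V) : y ∈ W := by
  classical
  -- The coefficients of this polynomial lie in `V` and are Galois invariant, so they come from `k`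
  -- and pass to `W`. Thus `y` is integral over `W`.
  let p : L[X] := ∏ σ : L ≃ₐ[k] L, (X - C (σ y))
  have hmonic : p.Monic := monic_prod_of_monic _ _ fun _ _ => monic_X_sub_C _
  have hroot : p.eval y = 0 := by
    simp only [p, eval_prod]
    exact Finset.prod_eq_zero (Finset.mem_univ 1) (by simp)
  have hV : p ∈ lifts V.subtype := by
    refine Subsemiring.prod_mem _ fun σ _ => ?_
    refine ⟨X - C ⟨σ y, hy σ⟩, ?_⟩
    simp
  have hfix (n : ℕ) : ∃ x : k, algebraMap k L x = p.coeff n := by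
    refine (IsGalois.mem_range_algebraMap_iff_fixed (p.coeff n)).2 fun τ => ?_
    have : p.map (τ : L →+* L) = p := by
      simp only [p, Polynomial.map_prod, Polynomial.map_sub, map_X, map_C]
      exact Fintype.prod_equiv (Equiv.mulLeft τ) _ _ fun σ => by simp
    conv_rhs => rw [← this]
    simp
  have hW : p ∈ lifts W.subtype := by
    rw [lifts_iff_coeff_lifts]
    intro n
    obtain ⟨x, hx⟩ := hfix n
    have hxV := (lifts_iff_coeff_lifts p).1 hV n
    rw [← hx] at hxV ⊢
    obtain ⟨z, hz⟩ := hxV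
    exact ⟨⟨_, hVW x (hz ▸ z.2)⟩, rfl⟩
  obtain ⟨q, hq, -, hqm⟩ := lifts_and_natDegree_eq_and_monic hW hmonic
  have hint : IsIntegral W y := ⟨q, hqm, by
    rw [← eval_map]
    rw [← hq] at hroot
    exact hroot⟩
  obtain ⟨z, hz⟩ := IsIntegrallyClosed.isIntegral_iff.1 hint
  exact hz ▸ z.2

end

/-- If two valuation rings of a finite Galois extension, both containing an infinite field of
constants of the base field, have the same restriction to the base field, then one of them
contains a conjugate of the other. -/
theorem ValuationSubring.exists_algEquiv_forall_mem_imp {K k L : Type*} [Field K] [Infinite K]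
    [Field k] [Field L] [Algebra K k] [Algebra k L] [FiniteDimensional k L] [IsGalois k L]
    {V W : ValuationSubring L}
    (hK : ∀ c : K, algebraMap k L (algebraMap K k c) ∈ V)
    (hVW : ∀ x : k, algebraMap k L x ∈ V ↔ algebraMap k L x ∈ W) :
    ∃ σ : L ≃ₐ[k] L, ∀ x, σ x ∈ V → x ∈ W := by
  classical
  -- `B` consists of the elements with all conjugates in `V`. The ideals `m σ` and `n` below are the
  -- traces on `B` of the maximal ideals of the conjugates of `V` and of `W`.
  let B : Subring L := ⨅ σ : L ≃ₐ[k] L, V.toSubring.comap (σ : L →+* L)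
  have hB {y : L} : y ∈ B ↔ ∀ σ : L ≃ₐ[k] L, σ y ∈ V := by
    simp [B, Subring.mem_iInf]
  have hBW {y : L} (hy : y ∈ B) : y ∈ W :=
    mem_of_forall_algEquiv_mem (fun x => (hVW x).1) (hB.1 hy)
  have hBσ {y : L} (hy : y ∈ B) (σ : L ≃ₐ[k] L) : σ y ∈ B :=
    hB.2 fun τ => hB.1 hy (τ * σ)
  let m (σ : L ≃ₐ[k] L) : Ideal B := (IsLocalRing.maximalIdeal V).comap
    (((σ : L →+* L).comp B.subtype).codRestrict V.toSubring fun y => hB.1 y.2 σ)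
  have hm (σ : L ≃ₐ[k] L) (y : B) : y ∈ m σ ↔ σ y ∈ V.nonunits := by
    simp only [m, Ideal.mem_comap]
    exact (V.coe_mem_nonunits_iff).symm
  have hmprime (σ) : (m σ).IsPrime := Ideal.comap_isPrime _ _
  let n : Ideal B := (IsLocalRing.maximalIdeal W).comap
    (B.subtype.codRestrict W.toSubring fun y => hBW y.2)
  have hn (y : B) : y ∈ n ↔ (y : L) ∈ W.nonunits := by
    simp only [n, Ideal.mem_comap]
    exact (W.coe_mem_nonunits_iff).symm
  -- The norm of `y ∈ n` is a nonunit of `W` lying in `k`, hence a nonunit of `V`; so some conjugate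
  -- of `y` is a nonunit of `V`. Prime avoidance then gives `n ⊆ m σ₀`.
  have hsub : (n : Set B) ⊆ ⋃ σ ∈ (↑(Finset.univ : Finset (L ≃ₐ[k] L)) : Set (L ≃ₐ[k] L)),
      (m σ : Set B) := by
    intro y hy
    have hy' : (y : L) ∈ W.nonunits := (hn y).1 hy
    obtain ⟨x, hx⟩ : ∃ x : k, algebraMap k L x = ∏ σ : L ≃ₐ[k] L, σ (y : L) := by
      refine (IsGalois.mem_range_algebraMap_iff_fixed _).2 fun τ => ?_
      rw [map_prod]
      exact Fintype.prod_equiv (Equiv.mulLeft τ) _ _ fun σ => by simp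
    have hxW : algebraMap k L x ∈ W.nonunits := by
      rw [hx, W.mem_nonunits_iff, map_prod]
      rw [← Finset.mul_prod_erase _ _ (Finset.mem_univ (1 : L ≃ₐ[k] L))]
      refine mul_lt_one_of_lt_of_le (W.mem_nonunits_iff.1 hy') ?_
      refine Finset.prod_le_one' fun σ _ => ?_
      exact (W.valuation_le_one_iff _).2 (hBW (hBσ y.2 σ))
    have hxV : algebraMap k L x ∈ V.nonunits := by
      rw [mem_nonunits_iff_or] at hxW ⊢
      rwa [← map_inv₀, hVW, map_inv₀]
    by_contra hnot
    simp only [Set.mem_iUnion, not_exists, Finset.coe_univ, Set.mem_univ, SetLike.mem_coe,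
      forall_true_left, hm] at hnot
    have hone (σ : L ≃ₐ[k] L) : V.valuation (σ y) = 1 := by
      refine le_antisymm ((V.valuation_le_one_iff _).2 (hB.1 y.2 σ)) ?_
      exact not_lt.1 fun h => hnot σ (V.mem_nonunits_iff.2 h)
    rw [hx, V.mem_nonunits_iff, map_prod] at hxV
    simp [hone] at hxV
  obtain ⟨σ₀, -, hσ₀⟩ := (Ideal.subset_union_prime 1 1 fun σ _ _ _ => hmprime σ).1 hsub
  refine ⟨σ₀, fun x hx => ?_⟩
  -- Each conjugate of `x` is congruent to at most one constant. As `K` is infinite, some `c` avoids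
  -- them all, which puts `(x - c)⁻¹` in `B`.
  have hbad (σ : L ≃ₐ[k] L) :
      {c : K | σ x - algebraMap k L (algebraMap K k c) ∈ V.nonunits}.Subsingleton := by
    intro c hc d hd
    by_contra hne
    have h1 : algebraMap k L (algebraMap K k (d - c)) ∈ V.nonunits := by
      have := V.nonunits.sub_mem hc hd
      rw [map_sub, map_sub]
      convert this using 1
      ring
    rw [mem_nonunits_iff_or] at h1
    rcases h1 with h1 | h1
    · simp [sub_eq_zero] at h1
      exact hne h1.symm
    · exact h1 (by rw [← map_inv₀, ← map_inv₀]; exact hK _)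
  obtain ⟨c, hc⟩ : ∃ c : K, ∀ σ : L ≃ₐ[k] L,
      σ x - algebraMap k L (algebraMap K k c) ∉ V.nonunits := by
    have hfin : (⋃ σ : L ≃ₐ[k] L,
        {c : K | σ x - algebraMap k L (algebraMap K k c) ∈ V.nonunits}).Finite :=
      Set.finite_iUnion fun σ => (hbad σ).finite
    obtain ⟨c, hc⟩ := hfin.infinite_compl.nonempty
    exact ⟨c, by simpa using hc⟩
  set a : L := algebraMap k L (algebraMap K k c) with ha
  have hσa (σ : L ≃ₐ[k] L) : σ a = a := σ.commutes _
  have hne : x - a ≠ 0 := by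
    intro h
    refine hc 1 ?_
    rw [mem_nonunits_iff_or]
    exact Or.inl (by simpa using h)
  have hyB : (x - a)⁻¹ ∈ B := hB.2 fun σ => by
    rw [map_inv₀, map_sub, hσa]
    have := hc σ
    rw [mem_nonunits_iff_or] at this
    push Not at this
    exact this.2
  -- Since `σ₀ x - c` lies in `V`, its inverse is not a nonunit of `V`. So `(x - c)⁻¹` is outside `m
  -- σ₀`, hence outside `n`, and `x - c` lies in `W`.
  have hyn : (⟨_, hyB⟩ : B) ∉ n := fun h => by
    have h2 := (hm σ₀ _).1 (hσ₀ h)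
    rw [map_inv₀, map_sub, hσa, inv_mem_nonunits_iff] at h2
    rcases h2 with h2 | h2
    · refine hne (σ₀.injective ?_)
      rw [map_sub, hσa, h2, map_zero]
    · exact h2 (V.toSubring.sub_mem hx (hK c))
  have hxa : x - a ∈ W := by
    have := (hn _).not.1 hyn
    rw [inv_mem_nonunits_iff] at this
    push Not at this
    exact this.2
  have haW : a ∈ W := (hVW _).1 (hK c)
  simpa using W.toSubring.add_mem hxa haW

/-- A consequence of Krull's intersection theorem. -/
theorem Ideal.eq_zero_of_forall_exists_mul_eq_pow_mul {A : Type*} [CommRing A] [IsDomain A]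
    [IsNoetherianRing A] (q : Ideal A) [q.IsPrime] {b g : A} (hb : b ∈ q)
    (h : ∀ i : ℕ, ∃ c d : A, d ∉ q ∧ g * d = b ^ i * c) : g = 0 := by
  let S := Localization.AtPrime q
  have : IsNoetherianRing S := IsLocalization.isNoetherianRing q.primeCompl S inferInstance
  have hinj : Function.Injective (algebraMap A S) :=
    IsLocalization.injective S q.primeCompl_le_nonZeroDivisors
  have hmem : algebraMap A S g ∈ ⨅ i : ℕ, IsLocalRing.maximalIdeal S ^ i := by
    rw [Ideal.mem_iInf]
    intro i
    obtain ⟨c, d, hd, hgd⟩ := h i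
    have hu : IsUnit (algebraMap A S d) := IsLocalization.map_units S (⟨d, hd⟩ : q.primeCompl)
    rw [← Ideal.mul_unit_mem_iff_mem _ hu, ← map_mul, hgd, map_mul, map_pow]
    refine Ideal.mul_mem_right _ _ (Ideal.pow_mem_pow ?_ i)
    exact (IsLocalization.AtPrime.to_map_mem_maximal_iff S q b).2 hb
  rw [Ideal.iInf_pow_eq_bot_of_isLocalRing _ (IsLocalRing.maximalIdeal.isMaximal S).ne_top] at hmem
  exact hinj (by simpa using hmem)

/-! ### Local structure of the curve at a smooth point -/

namespace PlaneCurve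

open MvPolynomial Matrix

variable {F K : Type*} [Field F] [Field K] [Algebra F K] (C : PlaneCurve F K)

/-- The class of a polynomial in the fraction field of the homogeneous coordinate ring. -/
noncomputable def toFrac : MvPolynomial (Fin 3) K →+* FractionRing C.CoordRing :=
  (algebraMap C.CoordRing _).comp (Ideal.Quotient.mk _)

theorem frac_eq (a b : MvPolynomial (Fin 3) K) : C.frac a b = C.toFrac a / C.toFrac b := rfl

theorem toFrac_C (c : K) :
    C.toFrac (MvPolynomial.C c) = algebraMap K (FractionRing C.CoordRing) c := rfl

theorem toFrac_eq_zero_iff {a : MvPolynomial (Fin 3) K} : C.toFrac a = 0 ↔ C.equation ∣ a := by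
  rw [toFrac, RingHom.comp_apply, FaithfulSMul.algebraMap_eq_zero_iff,
    Ideal.Quotient.eq_zero_iff_dvd]

@[simp]
theorem toFrac_equation : C.toFrac C.equation = 0 := C.toFrac_eq_zero_iff.2 dvd_rfl

theorem equation_isHomogeneous : C.equation.IsHomogeneous C.degree := C.isHomogeneous.map _

theorem degree_ne_zero : C.degree ≠ 0 := by
  intro h
  have h0 := C.equation_isHomogeneous
  rw [h, ← totalDegree_zero_iff_isHomogeneous, totalDegree_eq_zero_iff_eq_C] at h0
  have hirr : Irreducible C.equation := C.irreducible
  rw [h0] at hirr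
  refine hirr.not_isUnit (IsUnit.map MvPolynomial.C (isUnit_iff_ne_zero.2 fun h => ?_))
  rw [h, map_zero] at hirr
  exact hirr.ne_zero rfl

variable {C} {R : ProjPlane K}

theorem OnCurve.eval_eq_zero (hR : C.OnCurve R) {a : MvPolynomial (Fin 3) K}
    (h : C.toFrac a = 0) : eval R.rep a = 0 := by
  obtain ⟨b, rfl⟩ := C.toFrac_eq_zero_iff.1 h
  rw [map_mul, show eval R.rep C.equation = 0 from hR, zero_mul]

theorem OnCurve.gradient_dotProduct_rep (hR : C.OnCurve R) : C.gradient R ⬝ᵥ R.rep = 0 := by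
  have h := congrArg (eval R.rep) C.equation_isHomogeneous.sum_X_mul_pderiv
  rw [map_sum, map_nsmul, show eval R.rep C.equation = 0 from hR, smul_zero] at h
  rw [← h]
  exact Finset.sum_congr rfl fun i _ => by rw [map_mul, eval_X, mul_comm]; rfl

variable {β : Fin 3 → K}

/-- Differentiating the decomposition at `R` gives `∇ = f₁(R) β + f₂(R) ∇` for the gradient `∇` at
`R`; independence of `β` and `∇` yields the two values. -/
theorem IsSmoothAt.exists_equation_eq (hR : C.IsSmoothAt R)
    (hβ : LinearIndependent K ![β, C.gradient R]) (hβR : β ⬝ᵥ R.rep = 0) :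
    ∃ (m : ℕ) (f₁ f₂ : MvPolynomial (Fin 3) K), f₁.IsHomogeneous m ∧ f₂.IsHomogeneous m ∧
      eval R.rep f₁ = 0 ∧ eval R.rep f₂ = 1 ∧
      C.equation = linForm β * f₁ + linForm (C.gradient R) * f₂ := by
  obtain ⟨m, hm⟩ := Nat.exists_eq_succ_of_ne_zero C.degree_ne_zero
  have hhom := C.equation_isHomogeneous
  rw [hm] at hhom
  obtain ⟨f₁, f₂, h₁, h₂, h⟩ := hhom.exists_eq_linForm_mul_add_linForm_mul R.rep_nonzero hβ hβR
    hR.1.gradient_dotProduct_rep hR.1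
  have hgrad : eval R.rep f₁ • β + (eval R.rep f₂ - 1) • C.gradient R = 0 := by
    funext i
    have h' : C.gradient R i = eval R.rep (pderiv i C.equation) := rfl
    rw [h] at h'
    simp only [Derivation.leibniz, map_add, map_mul, smul_eq_mul, pderiv_linForm, eval_linForm,
      eval_C, hβR, hR.1.gradient_dotProduct_rep, zero_mul, zero_add] at h'
    simp only [Pi.add_apply, Pi.smul_apply, smul_eq_mul, Pi.zero_apply]
    linear_combination -h'
  obtain ⟨h3, h4⟩ := LinearIndependent.pair_iff.1 hβ _ _ hgrad
  exact ⟨m, f₁, f₂, h₁, h₂, h3, sub_eq_zero.1 h4, h⟩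

/-- On the curve the tangent form times `f₂` equals `-β f₁`, with `f₂` nonzero at `R`. So `β` alone
generates, locally at `R`, the forms vanishing there. -/
theorem IsSmoothAt.exists_toFrac_mul_eq (hR : C.IsSmoothAt R)
    (hβ : LinearIndependent K ![β, C.gradient R]) (hβR : β ⬝ᵥ R.rep = 0) {n : ℕ}
    {g : MvPolynomial (Fin 3) K} (hg : g.IsHomogeneous (n + 1)) (hg0 : eval R.rep g = 0) :
    ∃ (m : ℕ) (c d : MvPolynomial (Fin 3) K), c.IsHomogeneous (n + m) ∧ d.IsHomogeneous m ∧
      eval R.rep d ≠ 0 ∧ C.toFrac g * C.toFrac d = C.toFrac (linForm β) * C.toFrac c := by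
  obtain ⟨m, f₁, f₂, h₁, h₂, -, e₂, h⟩ := hR.exists_equation_eq hβ hβR
  obtain ⟨g₁, g₂, k₁, k₂, rfl⟩ := hg.exists_eq_linForm_mul_add_linForm_mul R.rep_nonzero hβ hβR
    hR.1.gradient_dotProduct_rep hg0
  refine ⟨m, g₁ * f₂ - g₂ * f₁, f₂, (k₁.mul h₂).sub (k₂.mul h₁), h₂, by simp [e₂], ?_⟩
  have h' := congrArg C.toFrac h
  simp only [toFrac_equation, map_add, map_mul, map_sub] at h' ⊢
  linear_combination -C.toFrac g₂ * h'

theorem IsSmoothAt.toFrac_linForm_ne_zero (hR : C.IsSmoothAt R)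
    (hβ : LinearIndependent K ![β, C.gradient R]) : C.toFrac (linForm β) ≠ 0 := by
  intro h
  obtain ⟨a, ha⟩ := C.toFrac_eq_zero_iff.1 h
  have hgrad : (1 : K) • β + (-eval R.rep a) • C.gradient R = 0 := by
    funext i
    have h' := congrArg (fun f => eval R.rep (pderiv i f)) ha
    simp only [Derivation.leibniz, map_add, smul_eq_mul, map_mul, pderiv_linForm, eval_C,
      show eval R.rep C.equation = 0 from hR.1, zero_mul, zero_add] at h'
    simp [h', gradient]
  exact one_ne_zero (LinearIndependent.pair_iff.1 hβ _ _ hgrad).1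

/-- This is the ideal of the point `R.rep` on the affine cone over the curve. Working on the cone
avoids dehomogenizing. -/
theorem OnCurve.exists_ideal (hR : C.OnCurve R) :
    ∃ q : Ideal C.CoordRing, q.IsPrime ∧
      ∀ a : MvPolynomial (Fin 3) K, Ideal.Quotient.mk _ a ∈ q ↔ eval R.rep a = 0 := by
  let φ : C.CoordRing →+* K := Ideal.Quotient.lift _ (eval R.rep) fun a ha => by
    obtain ⟨b, rfl⟩ := Ideal.mem_span_singleton.1 ha
    rw [map_mul, show eval R.rep C.equation = 0 from hR, zero_mul]
  exact ⟨RingHom.ker φ, RingHom.ker_isPrime φ, fun a => by simp [φ, RingHom.mem_ker]⟩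

/-- Every form is, up to forms that do not vanish at the smooth point `R`, a power of a linear form
that vanishes at `R` but not on the tangent line at `R`. -/
theorem IsSmoothAt.exists_toFrac_mul_eq_pow_mul (hR : C.IsSmoothAt R)
    (hβ : LinearIndependent K ![β, C.gradient R]) (hβR : β ⬝ᵥ R.rep = 0) {n : ℕ}
    {g : MvPolynomial (Fin 3) K} (hg : g.IsHomogeneous n) (hg0 : C.toFrac g ≠ 0) :
    ∃ (i l m : ℕ) (c d : MvPolynomial (Fin 3) K), c.IsHomogeneous l ∧ d.IsHomogeneous m ∧
      n + m = i + l ∧ eval R.rep c ≠ 0 ∧ eval R.rep d ≠ 0 ∧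
      C.toFrac g * C.toFrac d = C.toFrac (linForm β) ^ i * C.toFrac c := by
  -- If dividing by `β` never stopped, `g` would be divisible by every power of `β` in the local
  -- ring of the cone at `R.rep`, hence zero by Krull.
  by_contra! hcon
  have key (i : ℕ) : ∃ (l m : ℕ) (c d : MvPolynomial (Fin 3) K), c.IsHomogeneous l ∧
      d.IsHomogeneous m ∧ n + m = i + l ∧ eval R.rep d ≠ 0 ∧
      C.toFrac g * C.toFrac d = C.toFrac (linForm β) ^ i * C.toFrac c := by
    induction i with
    | zero => exact ⟨n, 0, g, 1, hg, isHomogeneous_one _ _, by simp, by simp, by simp⟩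
    | succ i ih =>
      obtain ⟨l, m, c, d, hc, hd, hdeg, hd0, h⟩ := ih
      have hc0 : eval R.rep c = 0 := by
        by_contra hc0
        exact hcon i l m c d hc hd hdeg hc0 hd0 h
      cases l with
      | zero =>
        rw [← totalDegree_zero_iff_isHomogeneous, totalDegree_eq_zero_iff_eq_C] at hc
        rw [hc, eval_C] at hc0
        rw [hc, hc0] at h
        simp only [map_zero, mul_zero, mul_eq_zero, hg0, false_or] at h
        exact (hd0 (hR.1.eval_eq_zero h)).elim
      | succ l =>
        obtain ⟨m', c', d', hc', hd', hd0', h'⟩ := hR.exists_toFrac_mul_eq hβ hβR hc hc0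
        refine ⟨l + m', m + m', c', d * d', hc', hd.mul hd', by omega, by simp [hd0, hd0'], ?_⟩
        rw [map_mul]
        linear_combination C.toFrac d' * h + C.toFrac (linForm β) ^ i * h'
  obtain ⟨q, hq, hmem⟩ := hR.1.exists_ideal
  have hinj := FaithfulSMul.algebraMap_injective C.CoordRing (FractionRing C.CoordRing)
  refine hg0 (hinj.eq_iff' (map_zero _) |>.2 ?_)
  refine q.eq_zero_of_forall_exists_mul_eq_pow_mul ((hmem (linForm β)).2 (by simpa using hβR))
    fun i => ?_
  obtain ⟨l, m, c, d, -, -, -, hd, h⟩ := key i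
  refine ⟨Ideal.Quotient.mk _ c, Ideal.Quotient.mk _ d, (hmem d).not.2 hd, hinj ?_⟩
  simpa [toFrac] using h

variable (C) in
/-- The quotient of two forms of the same degree, as a rational function on the curve. -/
noncomputable def ratio {n : ℕ} {a b : MvPolynomial (Fin 3) K} (ha : a.IsHomogeneous n)
    (hb : b.IsHomogeneous n) : C.functionField :=
  ⟨C.frac a b, IntermediateField.subset_adjoin _ _ ⟨n, a, b, ha, hb, rfl⟩⟩

theorem coe_ratio {n : ℕ} {a b : MvPolynomial (Fin 3) K} (ha : a.IsHomogeneous n)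
    (hb : b.IsHomogeneous n) :
    (C.ratio ha hb : FractionRing C.CoordRing) = C.toFrac a / C.toFrac b := rfl

theorem exists_eq_ratio (x : C.functionField) :
    ∃ (n : ℕ) (a b : MvPolynomial (Fin 3) K) (ha : a.IsHomogeneous n) (hb : b.IsHomogeneous n),
      C.toFrac b ≠ 0 ∧ x = C.ratio ha hb := by
  suffices ∀ y ∈ C.functionField, ∃ (n : ℕ) (a b : MvPolynomial (Fin 3) K),
      a.IsHomogeneous n ∧ b.IsHomogeneous n ∧ C.toFrac b ≠ 0 ∧ y = C.frac a b by
    obtain ⟨n, a, b, ha, hb, hb0, h⟩ := this x x.2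
    exact ⟨n, a, b, ha, hb, hb0, Subtype.ext h⟩
  intro y hy
  -- Generators with zero denominator, and the inverse of zero, equal `0` by the convention on
  -- division and are rewritten as `0 / 1`.
  have hzero : ∃ (n : ℕ) (a b : MvPolynomial (Fin 3) K),
      a.IsHomogeneous n ∧ b.IsHomogeneous n ∧ C.toFrac b ≠ 0 ∧ 0 = C.frac a b :=
    ⟨0, 0, 1, isHomogeneous_zero _ _ _, isHomogeneous_one _ _, by simp, by simp [frac_eq]⟩
  induction hy using IntermediateField.adjoin_induction with
  | mem x h =>
    obtain ⟨n, a, b, ha, hb, rfl⟩ := h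
    by_cases hb0 : C.toFrac b = 0
    · simpa [frac_eq, hb0] using hzero
    · exact ⟨n, a, b, ha, hb, hb0, rfl⟩
  | algebraMap c =>
    exact ⟨0, MvPolynomial.C c, 1, isHomogeneous_C _ _, isHomogeneous_one _ _, by simp,
      by simp [frac_eq, toFrac_C]⟩
  | add x y _ _ hx hy =>
    obtain ⟨n, a, b, ha, hb, hb0, rfl⟩ := hx
    obtain ⟨m, c, d, hc, hd, hd0, rfl⟩ := hy
    refine ⟨n + m, a * d + b * c, b * d, (ha.mul hd).add (hb.mul hc), hb.mul hd, ?_, ?_⟩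
    · simp [hb0, hd0]
    · simp only [frac_eq, map_add, map_mul]
      exact div_add_div _ _ hb0 hd0
  | inv x _ hx =>
    obtain ⟨n, a, b, ha, hb, hb0, rfl⟩ := hx
    by_cases ha0 : C.toFrac a = 0
    · simpa [frac_eq, ha0] using hzero
    · exact ⟨n, b, a, hb, ha, ha0, by simp [frac_eq]⟩
  | mul x y _ _ hx hy =>
    obtain ⟨n, a, b, ha, hb, hb0, rfl⟩ := hx
    obtain ⟨m, c, d, hc, hd, hd0, rfl⟩ := hy
    refine ⟨n + m, a * c, b * d, ha.mul hc, hb.mul hd, by simp [hb0, hd0], ?_⟩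
    simp only [frac_eq, map_mul]
    exact div_mul_div_comm _ _ _ _

/-! ### Places over a smooth point -/

namespace Place

variable {v : C.Place} {n : ℕ} {a b : MvPolynomial (Fin 3) K}

theorem LiesOver.ratio_mem_nonunits (hv : v.LiesOver R) (ha : a.IsHomogeneous n)
    (hb : b.IsHomogeneous n) (hb0 : eval R.rep b ≠ 0) (ha0 : eval R.rep a = 0) :
    C.ratio ha hb ∈ v.ring.nonunits :=
  (hv.2 n a b _ ha hb hb0 rfl).2 ha0

theorem LiesOver.valuation_ratio_eq_one (hv : v.LiesOver R) (ha : a.IsHomogeneous n)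
    (hb : b.IsHomogeneous n) (hb0 : eval R.rep b ≠ 0) (ha0 : eval R.rep a ≠ 0) :
    v.ring.valuation (C.ratio ha hb) = 1 := by
  have h1 := (v.ring.valuation_le_one_iff _).2 (hv.2 n a b (C.ratio ha hb) ha hb hb0 rfl).1
  have h2 := (v.ring.valuation_le_one_iff _).2 (hv.2 n b a (C.ratio hb ha) hb ha ha0 rfl).1
  have h3 : C.ratio hb ha = (C.ratio ha hb)⁻¹ := Subtype.ext (by simp [coe_ratio])
  have ha' : C.toFrac a ≠ 0 := fun h => ha0 (hv.1.eval_eq_zero h)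
  have hb' : C.toFrac b ≠ 0 := fun h => hb0 (hv.1.eval_eq_zero h)
  have hne : C.ratio ha hb ≠ 0 := fun h =>
    div_ne_zero ha' hb' (congrArg Subtype.val h)
  rw [h3, map_inv₀, inv_le_one₀ (zero_lt_iff.2 ((Valuation.ne_zero_iff _).2 hne))] at h2
  exact le_antisymm h1 h2

/-- `t = β/γ` is a uniformizer: splitting numerator and denominator into powers of `β` and local
units gives `x t^i' = t^i u` with `u` a unit, and `x` being a nonunit forces `i' < i`. -/
theorem LiesOver.exists_eq_ratio_mul (hv : v.LiesOver R) (hR : C.IsSmoothAt R)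
    (hβ : LinearIndependent K ![β, C.gradient R]) (hβR : β ⬝ᵥ R.rep = 0) {γ : Fin 3 → K}
    (hγR : γ ⬝ᵥ R.rep ≠ 0) {x : C.functionField} (hx : x ∈ v.ring.nonunits) :
    ∃ y ∈ v.ring, x = C.ratio (isHomogeneous_linForm β) (isHomogeneous_linForm γ) * y := by
  rcases eq_or_ne x 0 with rfl | hx0
  · exact ⟨0, v.ring.zero_mem, by simp⟩
  obtain ⟨n, g, h, hg, hh, hh0, rfl⟩ := exists_eq_ratio x
  have hg0 : C.toFrac g ≠ 0 := fun h0 => hx0 (Subtype.ext (by simp [coe_ratio, h0]))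
  obtain ⟨i, l, m, c, d, hc, hd, hdeg, hc0, hd0, hgd⟩ :=
    hR.exists_toFrac_mul_eq_pow_mul hβ hβR hg hg0
  obtain ⟨i', l', m', c', d', hc', hd', hdeg', hc0', hd0', hhd⟩ :=
    hR.exists_toFrac_mul_eq_pow_mul hβ hβR hh hh0
  have hγ0 : eval R.rep (linForm γ) ≠ 0 := by simpa using hγR
  have hβ0 : eval R.rep (linForm β) = 0 := by simpa using hβR
  set t := C.ratio (isHomogeneous_linForm β) (isHomogeneous_linForm γ) with ht
  have htv : v.ring.valuation t < 1 :=
    v.ring.mem_nonunits_iff.1 (hv.ratio_mem_nonunits _ _ hγ0 hβ0)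
  have ne (a : MvPolynomial (Fin 3) K) (ha : eval R.rep a ≠ 0) : C.toFrac a ≠ 0 :=
    fun h => ha (hv.1.eval_eq_zero h)
  have hβ' := hR.toFrac_linForm_ne_zero hβ
  have ht0 : t ≠ 0 := fun h => div_ne_zero hβ' (ne _ hγ0) (congrArg Subtype.val h)
  -- The powers of `γ` give numerator and denominator of `u` the same degree and absorb the
  -- denominators of the powers of `t`.
  have hN : (c * d' * linForm γ ^ i).IsHomogeneous (n + m + m') := by
    have := (hc.mul hd').mul ((isHomogeneous_linForm γ).pow i)
    convert this using 1
    omega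
  have hD : (d * c' * linForm γ ^ i').IsHomogeneous (n + m + m') := by
    have := (hd.mul hc').mul ((isHomogeneous_linForm γ).pow i')
    convert this using 1
    omega
  set u := C.ratio hN hD with hu
  have hu1 : v.ring.valuation u = 1 :=
    hv.valuation_ratio_eq_one _ _ (by simp_all) (by simp_all)
  have heq : C.ratio hg hh * t ^ i' = t ^ i * u := by
    apply Subtype.ext
    have hd1 := ne _ hd0
    have hd1' := ne _ hd0'
    have hc1' := ne _ hc0'
    have hγ1 := ne _ hγ0
    have e1 : C.toFrac g = C.toFrac (linForm β) ^ i * C.toFrac c / C.toFrac d :=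
      eq_div_of_mul_eq hd1 hgd
    have e2 : C.toFrac h = C.toFrac (linForm β) ^ i' * C.toFrac c' / C.toFrac d' :=
      eq_div_of_mul_eq hd1' hhd
    change C.toFrac g / C.toFrac h * (C.toFrac (linForm β) / C.toFrac (linForm γ)) ^ i' =
      (C.toFrac (linForm β) / C.toFrac (linForm γ)) ^ i *
        (C.toFrac (c * d' * linForm γ ^ i) / C.toFrac (d * c' * linForm γ ^ i'))
    rw [e1, e2]
    simp only [map_mul, map_pow, div_pow]
    field_simp
  have hval := congrArg v.ring.valuation heq
  rw [map_mul, map_mul, map_pow, map_pow, hu1, mul_one] at hval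
  have htpos : 0 < v.ring.valuation t := zero_lt_iff.2 ((Valuation.ne_zero_iff _).2 ht0)
  have hlt : i' < i := by
    by_contra! hle
    have h1 : v.ring.valuation t ^ i' ≤ v.ring.valuation t ^ i :=
      pow_le_pow_right_of_le_one' htv.le hle
    rw [← hval] at h1
    have h2 : v.ring.valuation (C.ratio hg hh) * v.ring.valuation t ^ i' <
        v.ring.valuation t ^ i' :=
      mul_lt_of_lt_one_left (pow_pos htpos _) (v.ring.mem_nonunits_iff.1 hx)
    exact absurd h1 (not_le.2 h2)
  obtain ⟨j, rfl⟩ := Nat.exists_eq_add_of_lt hlt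
  refine ⟨t ^ j * u, (v.ring.valuation_le_one_iff _).1 ?_, ?_⟩
  · rw [map_mul, hu1, mul_one, map_pow]
    exact pow_le_one' htv.le _
  · refine mul_right_cancel₀ (pow_ne_zero i' ht0) ?_
    rw [heq]
    ring

/-- On the curve this quotient is `-f₁ / f₂`, which vanishes at `R`. It handles projection from `R`
itself, where both linear forms vanish at `R`. -/
theorem LiesOver.ratio_gradient_mem_nonunits (hv : v.LiesOver R) (hR : C.IsSmoothAt R)
    (hβ : LinearIndependent K ![β, C.gradient R]) (hβR : β ⬝ᵥ R.rep = 0) :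
    C.ratio (isHomogeneous_linForm (C.gradient R)) (isHomogeneous_linForm β) ∈
      v.ring.nonunits := by
  obtain ⟨m, f₁, f₂, h₁, h₂, e₁, e₂, h⟩ := hR.exists_equation_eq hβ hβR
  have hf₂ : C.toFrac f₂ ≠ 0 := fun h0 => by simpa [e₂] using hR.1.eval_eq_zero h0
  refine (hv.2 m (-f₁) f₂ _ h₁.neg h₂ (by simp [e₂]) ?_).2 (by simp [e₁])
  have h' := congrArg C.toFrac h
  rw [toFrac_equation, map_add, map_mul, map_mul] at h'
  rw [coe_ratio, frac_eq, div_eq_div_iff (hR.toFrac_linForm_ne_zero hβ) hf₂, map_neg]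
  linear_combination -h'

end Place

/-- A valuation ring dominating the local ring of the cone at `R.rep` is restricted to the function
field. The restriction is proper because `β / X i`, with `X i` nonzero at `R`, is a nonzero nonunit.
-/
theorem IsSmoothAt.exists_place_liesOver (hR : C.IsSmoothAt R)
    (hβ : LinearIndependent K ![β, C.gradient R]) (hβR : β ⬝ᵥ R.rep = 0) :
    ∃ v : C.Place, v.LiesOver R := by
  obtain ⟨q, hq, hmem⟩ := hR.1.exists_ideal
  let ι := algebraMap C.CoordRing (FractionRing C.CoordRing)
  let e : C.CoordRing ≃+* ι.range :=
    RingEquiv.ofBijective ι.rangeRestrict ⟨fun x y h => FaithfulSMul.algebraMap_injective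
      C.CoordRing (FractionRing C.CoordRing) (congrArg Subtype.val h), ι.rangeRestrict_surjective⟩
  obtain ⟨W, hW, hWq⟩ := Ideal.image_subset_nonunits_valuationSubring
    (q.comap (e.symm : ι.range →+* C.CoordRing)) (Ideal.comap_ne_top _ hq.ne_top)
  have hWmem (a) : C.toFrac a ∈ W := hW ⟨_, rfl⟩
  have hWnon (a) (ha : eval R.rep a = 0) : C.toFrac a ∈ W.nonunits := by
    refine hWq ⟨e (Ideal.Quotient.mk _ a), ?_, rfl⟩
    simpa using (hmem a).2 ha
  have hWone (a) (ha : eval R.rep a ≠ 0) : W.valuation (C.toFrac a) = 1 := by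
    have h1 : W.valuation (C.toFrac (a - MvPolynomial.C (eval R.rep a))) < 1 :=
      W.mem_nonunits_iff.1 (hWnon _ (by simp))
    have h2 : W.valuation (C.toFrac (MvPolynomial.C (eval R.rep a))) = 1 := by
      have h3 : MvPolynomial.C (eval R.rep a) * MvPolynomial.C (eval R.rep a)⁻¹ =
          (1 : MvPolynomial (Fin 3) K) := by
        rw [← map_mul, mul_inv_cancel₀ ha, map_one]
      have h4 := congrArg (W.valuation ∘ C.toFrac) h3
      simp only [Function.comp_apply, map_mul, map_one] at h4
      refine le_antisymm ((W.valuation_le_one_iff _).2 (hWmem _)) ?_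
      rw [← h4]
      exact mul_le_of_le_one_right' ((W.valuation_le_one_iff _).2 (hWmem _))
    rw [map_sub] at h1
    rw [← sub_add_cancel (C.toFrac a) (C.toFrac (MvPolynomial.C (eval R.rep a))),
      Valuation.map_add_eq_of_lt_right _ (by rwa [h2]), h2]
  have hfrac (a b) (hb : eval R.rep b ≠ 0) : W.valuation (C.frac a b) = W.valuation (C.toFrac a) := by
    rw [frac_eq, map_div₀, hWone b hb, div_one]
  refine ⟨⟨W.comap (algebraMap C.functionField (FractionRing C.CoordRing)), fun c => ?_, ?_⟩,
    hR.1, fun n a b f ha hb hb0 hf => ⟨?_, fun ha0 => ?_⟩⟩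
  · exact hWmem (MvPolynomial.C c)
  · intro htop
    obtain ⟨i, hi⟩ := Function.ne_iff.1 R.rep_nonzero
    set t := C.ratio (isHomogeneous_linForm β) (isHomogeneous_X K i) with ht
    have hXi : eval R.rep (X i : MvPolynomial (Fin 3) K) ≠ 0 := by simpa using hi
    have htW : W.valuation (t : FractionRing C.CoordRing) < 1 := by
      rw [show (t : FractionRing C.CoordRing) = C.frac (linForm β) (X i) from rfl,
        hfrac _ _ hXi]
      exact W.mem_nonunits_iff.1 (hWnon _ (by simpa using hβR))
    have h1 : t⁻¹ ∈ W.comap (algebraMap C.functionField (FractionRing C.CoordRing)) := by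
      rw [htop]; trivial
    have h2 : W.valuation (t : FractionRing C.CoordRing)⁻¹ ≤ 1 :=
      (W.valuation_le_one_iff _).2 h1
    have ht0 : (t : FractionRing C.CoordRing) ≠ 0 :=
      div_ne_zero (hR.toFrac_linForm_ne_zero hβ) fun h => hXi (hR.1.eval_eq_zero h)
    rw [map_inv₀, inv_le_one₀ (zero_lt_iff.2 ((Valuation.ne_zero_iff _).2 ht0))] at h2
    exact absurd htW (not_lt.2 h2)
  · change (f : FractionRing C.CoordRing) ∈ W
    rw [← W.valuation_le_one_iff, hf, hfrac _ _ hb0, W.valuation_le_one_iff]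
    exact hWmem a
  · have h1 : (f : FractionRing C.CoordRing) ∈ W.nonunits := by
      rw [W.mem_nonunits_iff, hf, hfrac _ _ hb0]
      exact W.mem_nonunits_iff.1 (hWnon a ha0)
    rw [ValuationSubring.mem_nonunits_iff_or] at h1 ⊢
    exact h1.imp (fun h => Subtype.ext h) id

end PlaneCurve

/-! ### Valuation rings on the field generated by one element -/

section
open Polynomial IntermediateField

theorem ValuationSubring.aeval_mem_of_mem_nonunits {K L : Type*} [Field K] [Field L] [Algebra K L]
    {V : ValuationSubring L} (hK : ∀ c : K, algebraMap K L c ∈ V) {t : L} (ht : t ∈ V.nonunits)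
    (p : K[X]) : aeval t p ∈ V := by
  induction p using Polynomial.induction_on' with
  | add p q hp hq => rw [map_add]; exact V.toSubring.add_mem hp hq
  | monomial n c =>
    rw [aeval_monomial]
    exact V.toSubring.mul_mem (hK c) (V.toSubring.pow_mem (V.nonunits_subset ht) n)

theorem ValuationSubring.aeval_mem_nonunits_iff {K L : Type*} [Field K] [Field L] [Algebra K L]
    {V : ValuationSubring L} (hK : ∀ c : K, algebraMap K L c ∈ V) {t : L} (ht : t ∈ V.nonunits)
    (p : K[X]) : aeval t p ∈ V.nonunits ↔ p.eval 0 = 0 := by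
  have h : aeval t p = t * aeval t p.divX + algebraMap K L (p.eval 0) := by
    conv_lhs => rw [← p.X_mul_divX_add]
    rw [map_add, map_mul, aeval_X, aeval_C, ← coeff_zero_eq_eval_zero]
  have h1 : t * aeval t p.divX ∈ V.nonunits := by
    rw [mem_nonunits_iff, map_mul]
    exact mul_lt_one_of_lt_of_le (V.mem_nonunits_iff.1 ht)
      ((V.valuation_le_one_iff _).2 (aeval_mem_of_mem_nonunits hK ht _))
  refine ⟨fun hp => ?_, fun hp => by rwa [h, hp, map_zero, add_zero]⟩
  have h2 : algebraMap K L (p.eval 0) ∈ V.nonunits := by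
    rw [h] at hp
    simpa using V.nonunits.sub_mem hp h1
  rcases V.mem_nonunits_iff_or.1 h2 with h3 | h3
  · simpa using h3
  · exact (h3 (by rw [← map_inv₀]; exact hK _)).elim

/-- A valuation ring that contains the constants and in which `t` is a nonunit is determined on the
field generated by `t`. -/
theorem ValuationSubring.mem_of_mem_adjoin_simple {K L : Type*} [Field K] [Field L] [Algebra K L]
    {V W : ValuationSubring L} (hV : ∀ c : K, algebraMap K L c ∈ V)
    (hW : ∀ c : K, algebraMap K L c ∈ W) {t : L} (htV : t ∈ V.nonunits) (htW : t ∈ W.nonunits)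
    {x : L} (hx : x ∈ K⟮t⟯) (hxV : x ∈ V) : x ∈ W := by
  classical
  rcases eq_or_ne x 0 with rfl | hx0
  · exact W.zero_mem
  obtain ⟨r, s, rfl⟩ := (mem_adjoin_simple_iff K x).1 hx
  rw [div_ne_zero_iff] at hx0
  obtain ⟨r', s', hcop, g, -, rfl, rfl⟩ : ∃ r' s' : K[X], IsCoprime r' s' ∧
      ∃ g, g ≠ 0 ∧ r = g * r' ∧ s = g * s' := by
    have hs : s ≠ 0 := by rintro rfl; simp at hx0
    have hg : EuclideanDomain.gcd r s ≠ 0 := fun h => hs (EuclideanDomain.gcd_eq_zero_iff.1 h).2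
    obtain ⟨r', hr'⟩ := EuclideanDomain.gcd_dvd_left r s
    obtain ⟨s', hs'⟩ := EuclideanDomain.gcd_dvd_right r s
    refine ⟨r', s', ?_, _, hg, hr', hs'⟩
    refine ⟨EuclideanDomain.gcdA r s, EuclideanDomain.gcdB r s, mul_left_cancel₀ hg ?_⟩
    have := EuclideanDomain.gcd_eq_gcd_ab r s
    linear_combination -this + EuclideanDomain.gcdA r s * -hr' + EuclideanDomain.gcdB r s * -hs'
  simp only [map_mul, mul_ne_zero_iff] at hx0 hxV ⊢
  rw [mul_div_mul_left _ _ hx0.1.1] at hxV ⊢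
  -- In lowest terms, a denominator vanishing at `0` would have a numerator not vanishing there, so
  -- the quotient would have a pole, against `hxV`.
  have hs0 : s'.eval 0 ≠ 0 := by
    intro hs0
    have hr0 : r'.eval 0 ≠ 0 := by
      intro hr0
      obtain ⟨a, b, hab⟩ := hcop
      simpa [hr0, hs0] using congrArg (eval 0) hab
    have h1 := (aeval_mem_nonunits_iff hV htV s').2 hs0
    refine hr0 ((aeval_mem_nonunits_iff hV htV r').1 ?_)
    rw [← div_mul_cancel₀ (aeval t r') hx0.2.2, mem_nonunits_iff, map_mul]
    rw [mul_comm]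
    exact mul_lt_one_of_lt_of_le (V.mem_nonunits_iff.1 h1) ((V.valuation_le_one_iff _).2 hxV)
  have hinv : (aeval t s')⁻¹ ∈ W := by
    have := (aeval_mem_nonunits_iff hW htW s').not.2 hs0
    rw [mem_nonunits_iff_or] at this
    push Not at this
    exact this.2
  rw [div_eq_mul_inv]
  exact W.toSubring.mul_mem (aeval_mem_of_mem_nonunits hW htW r') hinv

end

/-! ### Ramification and tangency at a Galois point -/

namespace PlaneCurve

open MvPolynomial Matrix IntermediateField

variable {F K : Type*} [Field F] [Field K] [Algebra F K] {C : PlaneCurve F K} {P Q R : ProjPlane K}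
  {α γ : Fin 3 → K}

theorem projectionField_le_adjoin (hαγ : LinearIndependent K ![α, γ]) (hα : α ⬝ᵥ P.rep = 0)
    (hγ : γ ⬝ᵥ P.rep = 0) (hγ0 : C.toFrac (linForm γ) ≠ 0) :
    C.projectionField P ≤ K⟮C.ratio (isHomogeneous_linForm α) (isHomogeneous_linForm γ)⟯ := by
  set t := C.ratio (isHomogeneous_linForm α) (isHomogeneous_linForm γ) with ht
  have key (a : MvPolynomial (Fin 3) K) (ha : a.IsHomogeneous 1) (ha0 : eval P.rep a = 0) :
      ∃ s u : K, C.toFrac a = ((algebraMap K C.functionField s * t + algebraMap K _ u :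
        C.functionField) : FractionRing C.CoordRing) * C.toFrac (linForm γ) := by
    obtain ⟨g₁, g₂, h₁, h₂, rfl⟩ :=
      ha.exists_eq_linForm_mul_add_linForm_mul P.rep_nonzero hαγ hα hγ ha0
    rw [← totalDegree_zero_iff_isHomogeneous, totalDegree_eq_zero_iff_eq_C] at h₁ h₂
    generalize coeff 0 g₁ = s at h₁
    generalize coeff 0 g₂ = u at h₂
    subst h₁ h₂
    refine ⟨s, u, ?_⟩
    have e1 : ((algebraMap K C.functionField s * t + algebraMap K _ u : C.functionField) :
        FractionRing C.CoordRing) = C.toFrac (MvPolynomial.C s) *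
          (C.toFrac (linForm α) / C.toFrac (linForm γ)) + C.toFrac (MvPolynomial.C u) := rfl
    rw [e1, map_add, map_mul, map_mul]
    field_simp
  refine adjoin_le_iff.2 ?_
  rintro f ⟨a, b, ha, hb, ha0, hb0, hf⟩
  obtain ⟨s, u, h1⟩ := key a ha ha0
  obtain ⟨s', u', h2⟩ := key b hb hb0
  have hf' : f = (algebraMap K C.functionField s * t + algebraMap K _ u) /
      (algebraMap K C.functionField s' * t + algebraMap K _ u') := by
    apply Subtype.ext
    rw [hf, frac_eq, h1, h2, mul_div_mul_right _ _ hγ0]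
    rfl
  have htm : t ∈ K⟮t⟯ := mem_adjoin_simple_self K t
  have hlin (s u : K) : algebraMap K C.functionField s * t + algebraMap K _ u ∈ K⟮t⟯ :=
    add_mem (mul_mem (IntermediateField.algebraMap_mem _ _) htm)
      (IntermediateField.algebraMap_mem _ _)
  rw [hf']
  exact div_mem (hlin s u) (hlin s' u')

/-- At a ramified place, the functions pulled back under the projection that vanish there vanish
at least doubly. -/
theorem Place.mem_sq_of_one_lt_ramificationIndex {v : C.Place} (he : 1 < v.ramificationIndex P)
    (x : C.projectionField P) (hx : (x : C.functionField) ∈ v.ring.nonunits) :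
    (⟨x, v.ring.nonunits_subset hx⟩ : v.ring) ∈ IsLocalRing.maximalIdeal v.ring ^ 2 := by
  let : Algebra (v.imageRing P) v.ring := (v.imageRingHom P).toAlgebra
  have hle : Ideal.map (algebraMap (v.imageRing P) v.ring)
      (IsLocalRing.maximalIdeal (v.imageRing P)) ≤ IsLocalRing.maximalIdeal v.ring ^ 2 :=
    Ideal.le_pow_of_le_ramificationIdx' he
  have hxA : x ∈ v.imageRing P := v.ring.nonunits_subset hx
  have hxm : (⟨x, hxA⟩ : v.imageRing P) ∈ IsLocalRing.maximalIdeal (v.imageRing P) := by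
    rw [← ValuationSubring.coe_mem_nonunits_iff, ValuationSubring.mem_nonunits_iff_or]
    exact (ValuationSubring.mem_nonunits_iff_or _).1 hx |>.imp (fun h => Subtype.ext h) id
  exact hle (Ideal.mem_map_of_mem _ hxm)

/-- If the projection from a Galois point `P` is ramified at a place on a line through `P`, then the
line is tangent to the curve at every smooth point other than `P`. -/
theorem IsGaloisPoint.not_linearIndependent [Infinite K] (hP : C.IsGaloisPoint P) {v : C.Place}
    (he : 1 < v.ramificationIndex P) (hαγ : LinearIndependent K ![α, γ]) (hα : α ⬝ᵥ P.rep = 0)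
    (hγ : γ ⬝ᵥ P.rep = 0)
    (hv : C.ratio (isHomogeneous_linForm α) (isHomogeneous_linForm γ) ∈ v.ring.nonunits)
    (hR : C.IsSmoothAt R) (hαR : α ⬝ᵥ R.rep = 0) (hγR : γ ⬝ᵥ R.rep ≠ 0) :
    ¬ LinearIndependent K ![α, C.gradient R] := by
  intro hli
  obtain ⟨w, hw⟩ := hR.exists_place_liesOver hli hαR
  have := hP.1
  have := hP.2
  set t := C.ratio (isHomogeneous_linForm α) (isHomogeneous_linForm γ) with ht
  have hγ0 : eval R.rep (linForm γ) ≠ 0 := by simpa using hγR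
  have hγ0' : C.toFrac (linForm γ) ≠ 0 := fun h => hγ0 (hR.1.eval_eq_zero h)
  have hwt : t ∈ w.ring.nonunits := hw.ratio_mem_nonunits _ _ hγ0 (by simpa using hαR)
  have hsub := projectionField_le_adjoin hαγ hα hγ hγ0'
  let T : C.projectionField P := ⟨t, subset_adjoin _ _ ⟨linForm α, linForm γ,
    isHomogeneous_linForm α, isHomogeneous_linForm γ, by simpa using hα, by simpa using hγ, rfl⟩⟩
  -- Both `v` and `w` lie over `t = 0`, so they cut out the same ring on the projection field.
  obtain ⟨σ, hσ⟩ := ValuationSubring.exists_algEquiv_forall_mem_imp (K := K)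
    (k := C.projectionField P) (V := w.ring) (W := v.ring) (fun c => w.constants_mem c)
    (fun x => ⟨ValuationSubring.mem_of_mem_adjoin_simple w.constants_mem v.constants_mem hwt hv
      (hsub x.2), ValuationSubring.mem_of_mem_adjoin_simple v.constants_mem w.constants_mem hv hwt
      (hsub x.2)⟩)
  have hσt : σ t = t := σ.commutes T
  -- As `σ` fixes `t`, the fact that `t` generates the maximal ideal at `w` is carried over to `v`.
  have hdiv (z : C.functionField) (hz : z ∈ v.ring.nonunits) : ∃ y ∈ v.ring, z = t * y := by
    have hσz : σ z ∈ w.ring.nonunits := by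
      rw [ValuationSubring.mem_nonunits_iff_or] at hz ⊢
      refine hz.imp (fun h => by rw [h, map_zero]) fun h h' => h (hσ _ ?_)
      rwa [map_inv₀]
    obtain ⟨y, hy, h⟩ := hw.exists_eq_ratio_mul hR hli hαR hγR hσz
    refine ⟨σ.symm y, hσ _ (by simpa using hy), σ.injective ?_⟩
    rw [map_mul, hσt, AlgEquiv.apply_symm_apply, h]
  have hsq := Place.mem_sq_of_one_lt_ramificationIndex he T hv
  let t' : v.ring := ⟨t, v.ring.nonunits_subset hv⟩
  have hmax : IsLocalRing.maximalIdeal v.ring ≤ Ideal.span {t'} := by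
    intro z hz
    obtain ⟨y, hy, h⟩ := hdiv z (v.ring.coe_mem_nonunits_iff.2 hz)
    exact Ideal.mem_span_singleton.2 ⟨⟨y, hy⟩, Subtype.ext h⟩
  -- Ramification puts `t` in the square of the maximal ideal, which is contained in `(t²)`. This
  -- makes the nonunit `t` a unit.
  have h2 : t' ∈ Ideal.span {t' ^ 2} := by
    rw [← Ideal.span_singleton_pow]
    exact Ideal.pow_right_mono hmax 2 hsq
  obtain ⟨y, hy⟩ := Ideal.mem_span_singleton.1 h2
  have ht0 : t' ≠ 0 := fun h =>
    div_ne_zero (hR.toFrac_linForm_ne_zero hli) hγ0' (congrArg (fun z : v.ring =>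
      ((z : C.functionField) : FractionRing C.CoordRing)) h)
  have h3 : t' * y = 1 := mul_left_cancel₀ ht0 (by rw [mul_one]; linear_combination -hy)
  have h4 : t' ∈ IsLocalRing.maximalIdeal v.ring := v.ring.coe_mem_nonunits_iff.1 hv
  exact (IsLocalRing.mem_maximalIdeal _).1 h4 (IsUnit.of_mul_eq_one y h3)

end PlaneCurve

/-- The image of `F` already supplies `q` roots of `X ^ q - X`, as many as the degree allows. -/
theorem FiniteField.mem_range_algebraMap_of_pow_card_eq {F K : Type*} [Field F] [Fintype F]
    [Field K] [Algebra F K] {x : K} (hx : x ^ Fintype.card F = x) :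
    x ∈ Set.range (algebraMap F K) := by
  classical
  let p : Polynomial K := Polynomial.X ^ Fintype.card F - Polynomial.X
  have hp : p ≠ 0 := FiniteField.X_pow_card_sub_X_ne_zero K Fintype.one_lt_card
  have hsub : Finset.univ.image (algebraMap F K) ⊆ p.roots.toFinset := by
    intro y hy
    obtain ⟨a, -, rfl⟩ := Finset.mem_image.1 hy
    simp [Polynomial.mem_roots hp, p, ← map_pow, FiniteField.pow_card]
  have hcard : p.roots.toFinset.card ≤ (Finset.univ.image (algebraMap F K)).card := by
    rw [Finset.card_image_of_injective _ (algebraMap F K).injective, Finset.card_univ]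
    refine (Multiset.toFinset_card_le _).trans ((Polynomial.card_roots' p).trans ?_)
    exact (FiniteField.X_pow_card_sub_X_natDegree_eq K Fintype.one_lt_card).le
  have hmem : x ∈ p.roots.toFinset := by simp [Polynomial.mem_roots hp, p, hx]
  rw [← Finset.eq_of_subset_of_card_le hsub hcard] at hmem
  simpa using hmem

/-! ### Points and lines of the plane -/

namespace ProjPlane

open Matrix

variable {K : Type*} [Field K] {P Q R : ProjPlane K} {α γ : Fin 3 → K}

theorem exists_dotProduct_eq_zero_and_ne_zero (h : P ≠ Q) :
    ∃ γ : Fin 3 → K, γ ⬝ᵥ P.rep = 0 ∧ γ ⬝ᵥ Q.rep ≠ 0 := by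
  obtain ⟨i, hi⟩ := Function.ne_iff.1 P.rep_nonzero
  simp only [Pi.zero_apply] at hi
  by_contra! hcon
  have key (j : Fin 3) : P.rep i * Q.rep j = P.rep j * Q.rep i := by
    have := hcon (Pi.single j (P.rep i) - Pi.single i (P.rep j))
      (by simp [sub_dotProduct, mul_comm])
    simpa [sub_dotProduct, sub_eq_zero] using this
  apply h
  rw [← P.mk_rep, ← Q.mk_rep, eq_comm, Projectivization.mk_eq_mk_iff']
  refine ⟨Q.rep i / P.rep i, ?_⟩
  funext j
  have := key j
  simp only [Pi.smul_apply, smul_eq_mul]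
  field_simp
  linear_combination -this

theorem dotProduct_ne_zero (hαγ : LinearIndependent K ![α, γ]) (hα : α ⬝ᵥ P.rep = 0)
    (hγ : γ ⬝ᵥ P.rep = 0) (h : P ≠ Q) (hαQ : α ⬝ᵥ Q.rep = 0) : γ ⬝ᵥ Q.rep ≠ 0 := by
  intro hγQ
  obtain ⟨δ, h1, h2⟩ := exists_dotProduct_eq_zero_and_ne_zero h
  obtain ⟨s, u, rfl⟩ :=
    exists_eq_smul_add_smul_of_dotProduct_eq_zero P.rep_nonzero hαγ hα hγ h1
  simp [add_dotProduct, hαQ, hγQ] at h2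

theorem lineThrough_eq (h : P ≠ Q) (hα0 : α ≠ 0) (hα : α ⬝ᵥ P.rep = 0) (hαQ : α ⬝ᵥ Q.rep = 0) :
    lineThrough P Q = {R | α ⬝ᵥ R.rep = 0} := by
  ext R
  simp only [lineThrough, Set.mem_ofPred_eq]
  rw [R.submodule_eq, P.submodule_eq, Q.submodule_eq, Submodule.span_singleton_le_iff_mem,
    ← Submodule.span_union, Set.singleton_union, Submodule.mem_span_pair]
  constructor
  · rintro ⟨s, u, hsu⟩
    simp [← hsu, dotProduct_add, hα, hαQ]
  · intro hR
    obtain ⟨s, u, hsu⟩ := exists_eq_smul_add_smul_of_dotProduct_eq_zero hα0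
      (Projectivization.linearIndependent_pair_iff_ne.2 h) (by rwa [dotProduct_comm])
      (by rwa [dotProduct_comm]) (by rwa [dotProduct_comm])
    exact ⟨s, u, hsu.symm⟩

theorem exists_linearIndependent_pair (P : ProjPlane K) (hα0 : α ≠ 0) :
    ∃ γ : Fin 3 → K, LinearIndependent K ![γ, α] ∧ γ ⬝ᵥ P.rep = 0 := by
  by_contra! hcon
  have hle : LinearMap.ker ((dotProductBilin K K).flip P.rep) ≤ Submodule.span K {α} := by
    intro γ hγ
    by_contra hmem
    refine hcon γ ?_ hγ
    rw [LinearIndependent.pair_symm_iff, LinearIndependent.pair_iff' hα0]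
    rintro a rfl
    exact hmem (Submodule.smul_mem _ _ (Submodule.mem_span_singleton_self α))
  have h1 := Submodule.finrank_mono hle
  rw [finrank_ker_flip_dotProductBilin P.rep_nonzero, finrank_span_singleton hα0] at h1
  omega

end ProjPlane

/-! ### Tangent lines and Frobenius -/

namespace PlaneCurve

open MvPolynomial Matrix

variable {F K : Type*} [Field F] [Field K] [Algebra F K] {C : PlaneCurve F K} {P Q R : ProjPlane K}

theorem mem_tangentLine : R ∈ C.tangentLine Q ↔ C.gradient Q ⬝ᵥ R.rep = 0 := Iff.rfl

theorem IsSmoothAt.mem_tangentLine (hR : C.IsSmoothAt R) : R ∈ C.tangentLine R :=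
  hR.1.gradient_dotProduct_rep

theorem IsGaloisPoint.exists_gradient_eq_smul [Infinite K] (hP : C.IsGaloisPoint P) {v : C.Place}
    (he : 1 < v.ramificationIndex P) (hv : v.LiesOver Q) (hQ : C.IsSmoothAt Q)
    (hPQ : P ∈ C.tangentLine Q) (hR : C.IsSmoothAt R) (hRQ : R ∈ C.tangentLine Q) (hRP : R ≠ P) :
    ∃ c : K, C.gradient R = c • C.gradient Q := by
  suffices ∃ γ : Fin 3 → K, LinearIndependent K ![C.gradient Q, γ] ∧ γ ⬝ᵥ P.rep = 0 ∧
      C.ratio (isHomogeneous_linForm (C.gradient Q)) (isHomogeneous_linForm γ) ∈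
        v.ring.nonunits by
    obtain ⟨γ, hli, hγ, hmem⟩ := this
    have h := hP.not_linearIndependent he hli hPQ hγ hmem hR hRQ
      (ProjPlane.dotProduct_ne_zero hli hPQ hγ hRP.symm hRQ)
    rw [LinearIndependent.pair_iff' hQ.2] at h
    push Not at h
    obtain ⟨c, hc⟩ := h
    exact ⟨c, hc.symm⟩
  -- It remains to see that `v` lies in the fibre of `T_Q`. For `P ≠ Q` a form `γ` with `γ(Q) ≠ 0`
  -- serves as denominator; for `P = Q` no such form exists and the local equation of the curve is
  -- used.
  rcases eq_or_ne P Q with rfl | hne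
  · obtain ⟨γ, hli, hγ⟩ := ProjPlane.exists_linearIndependent_pair P hQ.2
    exact ⟨γ, LinearIndependent.pair_symm_iff.1 hli, hγ, hv.ratio_gradient_mem_nonunits hQ hli hγ⟩
  · obtain ⟨γ, hγP, hγQ⟩ := ProjPlane.exists_dotProduct_eq_zero_and_ne_zero hne
    refine ⟨γ, ?_, hγP, hv.ratio_mem_nonunits _ _ (by simpa using hγQ)
      (by simpa using hQ.1.gradient_dotProduct_rep)⟩
    rw [LinearIndependent.pair_iff' hQ.2]
    rintro a rfl
    exact hγQ (by rw [smul_dotProduct, hQ.1.gradient_dotProduct_rep, smul_zero])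

/-- The tangency criterion is applied to the point `Q` itself and the line `PQ`, whose equation is
the cross product. -/
theorem IsGaloisPoint.mem_tangentLine [Infinite K] (hP : C.IsGaloisPoint P) {v : C.Place}
    (he : 1 < v.ramificationIndex P) (hv : v.LiesOver Q) (hQ : C.IsSmoothAt Q) (hPQ : P ≠ Q) :
    P ∈ C.tangentLine Q := by
  have hli : LinearIndependent K ![P.rep, Q.rep] :=
    Projectivization.linearIndependent_pair_iff_ne.2 hPQ
  let α := crossProduct P.rep Q.rep
  have hα0 : α ≠ 0 := crossProduct_ne_zero_iff_linearIndependent.2 hli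
  have hαP : α ⬝ᵥ P.rep = 0 := by rw [dotProduct_comm]; exact dot_self_cross _ _
  have hαQ : α ⬝ᵥ Q.rep = 0 := by rw [dotProduct_comm]; exact dot_cross_self _ _
  obtain ⟨γ, hγP, hγQ⟩ := ProjPlane.exists_dotProduct_eq_zero_and_ne_zero hPQ
  have hαγ : LinearIndependent K ![α, γ] := by
    rw [LinearIndependent.pair_iff' hα0]
    rintro a rfl
    exact hγQ (by rw [smul_dotProduct, hαQ, smul_zero])
  have h := hP.not_linearIndependent he hαγ hαP hγP (hv.ratio_mem_nonunits _ _
    (by simpa using hγQ) (by simpa using hαQ)) hQ hαQ hγQ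
  rw [LinearIndependent.pair_iff' hα0] at h
  push Not at h
  obtain ⟨c, hc⟩ := h
  rw [PlaneCurve.mem_tangentLine, ← hc, smul_dotProduct, hαP, smul_zero]

theorem exists_rep_frobeniusPoint (F : Type*) {K : Type*} [Fintype F] [Field K]
    (R : ProjPlane K) :
    ∃ a : K, a ≠ 0 ∧ (frobeniusPoint F R).rep = a • fun i => R.rep i ^ Fintype.card F := by
  obtain ⟨a, ha⟩ := Projectivization.exists_smul_eq_mk_rep K
    (fun i => R.rep i ^ Fintype.card F) (by
      intro h
      apply R.rep_nonzero
      funext i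
      exact eq_zero_of_pow_eq_zero (congrFun h i))
  exact ⟨a, a.ne_zero, ha.symm⟩

variable [Fintype F]

theorem eval_map_pow_card (f : MvPolynomial (Fin 3) F) (x : Fin 3 → K) :
    eval (fun i => x i ^ Fintype.card F) (map (algebraMap F K) f) =
      eval x (map (algebraMap F K) f) ^ Fintype.card F := by
  rw [eval_map, eval_map, ← aeval_def, ← aeval_def]
  exact (MvPolynomial.comp_aeval_apply (f := x) (FiniteField.frobeniusAlgHom F K) f).symm

/-- The partial derivatives have coefficients in `F`, so they commute with Frobenius. The scalar
comes from the choice of representative, raised to the degree of the derivatives. -/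
theorem exists_gradient_frobeniusPoint (R : ProjPlane K) :
    ∃ a : K, a ≠ 0 ∧
      C.gradient (frobeniusPoint F R) = a • fun i => C.gradient R i ^ Fintype.card F := by
  obtain ⟨a, ha, h⟩ := exists_rep_frobeniusPoint F R
  refine ⟨a ^ (C.degree - 1), pow_ne_zero _ ha, ?_⟩
  funext i
  simp only [gradient, equation, pderiv_map, h, Pi.smul_apply, smul_eq_mul]
  rw [← eval_map_pow_card]
  exact ((C.isHomogeneous.pderiv (i := i)).map _).eval_smul a _

theorem IsSmoothAt.frobeniusPoint (hR : C.IsSmoothAt R) : C.IsSmoothAt (frobeniusPoint F R) := by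
  constructor
  · obtain ⟨a, ha, h⟩ := exists_rep_frobeniusPoint F R
    have h0 : eval R.rep (map (algebraMap F K) C.poly) = 0 := hR.1
    rw [OnCurve, h, C.equation_isHomogeneous.eval_smul, equation, eval_map_pow_card, h0,
      zero_pow Fintype.card_ne_zero, mul_zero]
  · obtain ⟨a, ha, h⟩ := exists_gradient_frobeniusPoint (C := C) R
    rw [h]
    refine smul_ne_zero ha fun h0 => hR.2 ?_
    funext i
    exact eq_zero_of_pow_eq_zero (congrFun h0 i)

/-- If the tangent lines at `R` and at its Frobenius image agree, then the tangent line is defined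
over the base field. -/
theorem IsSmoothAt.isLineDefinedOver_tangentLine (hR : C.IsSmoothAt R) {c : K}
    (h : C.gradient (_root_.frobeniusPoint F R) = c • C.gradient R) :
    IsLineDefinedOver F (C.tangentLine R) := by
  obtain ⟨a, ha, h'⟩ := exists_gradient_frobeniusPoint (C := C) R
  rw [h'] at h
  have hi (i) : a * C.gradient R i ^ Fintype.card F = c * C.gradient R i := congrFun h i
  obtain ⟨j, hj⟩ := Function.ne_iff.1 hR.2
  simp only [Pi.zero_apply] at hj
  -- Proportionality of the gradient to its `q`-th power makes ratios of coordinates Frobenius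
  -- invariant, so they lie in `F`.
  have hmem (i) : C.gradient R i / C.gradient R j ∈ Set.range (algebraMap F K) := by
    refine FiniteField.mem_range_algebraMap_of_pow_card_eq ?_
    rw [div_pow, div_eq_div_iff (pow_ne_zero _ hj) hj]
    refine mul_left_cancel₀ ha ?_
    linear_combination C.gradient R j * hi i - C.gradient R i * hi j
  choose b hb using hmem
  refine ⟨b, fun h0 => ?_, ?_⟩
  · have := hb j
    rw [h0, div_self hj] at this
    simp at this
  · ext T
    simp only [tangentLine, Set.mem_ofPred_eq, hb, div_mul_eq_mul_div]
    rw [← Finset.sum_div, div_eq_zero_iff, or_iff_left hj]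

end PlaneCurve

theorem frobeniusPoint_injective {F K : Type*} [Field F] [Fintype F] [Field K] [Algebra F K]
    [IsAlgClosed K] : Function.Injective (frobeniusPoint F : ProjPlane K → ProjPlane K) := by
  intro R S h
  rw [frobeniusPoint, frobeniusPoint, Projectivization.mk_eq_mk_iff'] at h
  obtain ⟨a, ha⟩ := h
  -- A `q`-th root of the scalar turns proportionality of the `q`-th powers into proportionality of
  -- the coordinates.
  obtain ⟨b, rfl⟩ := IsAlgClosed.exists_pow_nat_eq a (n := Fintype.card F) Fintype.card_pos
  rw [← R.mk_rep, ← S.mk_rep, Projectivization.mk_eq_mk_iff']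
  refine ⟨b, funext fun i => ?_⟩
  have hi : b ^ Fintype.card F * S.rep i ^ Fintype.card F = R.rep i ^ Fintype.card F :=
    congrFun ha i
  rw [← mul_pow] at hi
  exact (FiniteField.frobeniusAlgHom F K).toRingHom.injective hi

theorem mainTheorem2 {F K : Type*} [Field F] [Fintype F] [Field K] [Algebra F K]
    [IsAlgClosure F K] (C : PlaneCurve F K) (hC : C.IsFrobeniusNonclassical)
    (P Q : ProjPlane K) (hP : C.IsGaloisPoint P) (hQ : C.IsSmoothAt Q)
    (hPQ : C.IsRamificationPoint P Q) :
    ((¬ C.OnCurve P ∨ C.IsSingularAt P) → IsLineDefinedOver F (lineThrough P Q)) ∧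
    (P = Q → IsLineDefinedOver F (C.tangentLine P)) ∧
    (C.IsSmoothAt P → P ≠ Q →
      (∃ Q' : ProjPlane K, C.IsSmoothAt Q' ∧ Q' ∈ lineThrough P Q ∧ Q' ≠ P ∧ Q' ≠ Q) →
      IsLineDefinedOver F (lineThrough P Q)) := by
  have : IsAlgClosed K := IsAlgClosure.isAlgClosed F
  have : Infinite K := IsAlgClosed.instInfinite
  obtain ⟨v, hv, he⟩ := hPQ
  have hline (h : P ≠ Q) : lineThrough P Q = C.tangentLine Q :=
    ProjPlane.lineThrough_eq h hQ.2 (hP.mem_tangentLine he hv hQ h) hQ.1.gradient_dotProduct_rep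
  -- Nonclassicality puts the smooth point `Q^q` on `T_Q`, so away from `P` its tangent is again
  -- `T_Q`.
  have hfrob (hPT : P ∈ C.tangentLine Q) (hne : frobeniusPoint F Q ≠ P) :
      IsLineDefinedOver F (C.tangentLine Q) := by
    obtain ⟨c, hc⟩ := hP.exists_gradient_eq_smul he hv hQ hPT hQ.frobeniusPoint (hC Q hQ) hne
    exact hQ.isLineDefinedOver_tangentLine hc
  refine ⟨fun hPC => ?_, ?_, fun hPC hne ⟨Q', hQ', hmem, hQ'P, hQ'Q⟩ => ?_⟩
  · have hPns : ¬ C.IsSmoothAt P := fun h => hPC.elim (fun h' => h' h.1) fun h' => h.2 h'.2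
    have hne : P ≠ Q := fun h => hPns (h ▸ hQ)
    rw [hline hne]
    exact hfrob (hP.mem_tangentLine he hv hQ hne) fun h => hPns (h ▸ hQ.frobeniusPoint)
  · rintro rfl
    by_cases hne : frobeniusPoint F P = P
    · exact hQ.isLineDefinedOver_tangentLine (c := 1) (by rw [hne, one_smul])
    · exact hfrob hQ.mem_tangentLine hne
  · have hPT := hP.mem_tangentLine he hv hQ hne
    rw [hline hne] at hmem ⊢
    by_cases hfQ : frobeniusPoint F Q = P
    · obtain ⟨c, hc⟩ := hP.exists_gradient_eq_smul he hv hQ hPT hQ' hmem hQ'P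
      have hc0 : c ≠ 0 := by
        rintro rfl
        exact hQ'.2 (by rw [hc, zero_smul])
      have hT : C.tangentLine Q' = C.tangentLine Q := by
        ext T
        rw [PlaneCurve.mem_tangentLine, PlaneCurve.mem_tangentLine, hc, smul_dotProduct,
          smul_eq_mul, mul_eq_zero, or_iff_right hc0]
      -- Here `Q^q = P`, so `Q'^q ≠ P` by injectivity, and `Q'` can play the role of `Q` on the
      -- common tangent line.
      obtain ⟨d, hd⟩ := hP.exists_gradient_eq_smul he hv hQ hPT hQ'.frobeniusPoint
        (hT ▸ hC Q' hQ') fun h => hQ'Q (frobeniusPoint_injective (h.trans hfQ.symm))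
      rw [← hT]
      refine hQ'.isLineDefinedOver_tangentLine (c := d / c) ?_
      rw [hd, hc, smul_smul, div_mul_cancel₀ _ hc0]
    · exact hfrob hPT hfQ
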